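/- Fix an even integer $n\ge 2$ and a set $S\subset\{0,1,\dots,n-1\}$ with $|S|=n/2$, and let $$\mathfrak S=\{1\}\cup\{m\in\mathbb Z_{+}: m=qn+r \text{ for some } r\in S,\ q\in\mathbb Z\}.$$ Consider the following process. Start with $R$ sticks, each of positive integer length $L\notin\mathfrak S$. A stick is dead if its length lies in $\mathfrak S$, and alive otherwise. At each level, every living stick, of length $\ell$ say, is cut, independently of all other sticks, into two sticks of lengths $x$ and $\ell-x$, where $x$ is uniformly distributed on $\{1,\dots,\ell-1\}$; dead sticks are never cut again. The process ends when all sticks are dead (which happens after at most $L$ levels); let $\{X_i\}$ be the resulting finite collection of ending stick lengths, counted with multiplicity. Fix a real base $B>1$. The significand of $x>0$ is the number $S_B(x)\in[1,B)$ with $x=S_B(x)B^{k}$, $k=\lfloor\log_B x\rfloor$. For $s\in[1,B)$ let $$P_{L,R}(s)=\frac{\#\{i: S_B(X_i)\le s\}}{\#\{X_i\}}.$$ **Theorem.** The collection of ending stick lengths converges to strong Benford behavior in base $B$ as $L\to\infty$, provided $R>(\log L)^3$. That is, for all sequences of positive integers $L_k\notin\mathfrak S$ and $R_k$ with $L_k\to\infty$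 and $R_k>(\log L_k)^3$ for every $k$ (natural logarithm), and for every $s\in[1,B)$, $$\lim_{k\to\infty}\mathbb E\big[P_{L_k,R_k}(s)\big]=\log_B s\qquad\text{and}\qquad \lim_{k\to\infty}\operatorname{Var}\big[P_{L_k,R_k}(s)\big]=0 .$$ -/

import Mathlib

open Filter Topology MeasureTheory ProbabilityTheory

namespace StickFragmentation

/-- The significand of `x > 0` in base `B > 1`: the number `S ∈ [1, B)` with `x = S * B ^ k`,
where `k = ⌊log_B x⌋`. -/
noncomputable def significand (B x : ℝ) : ℝ := x / B ^ ⌊Real.logb B x⌋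

open Classical in
/-- The proportion of the entries of a finite collection of stick lengths (repetitions counted)
whose significand in base `B` is at most `s`. -/
noncomputable def proportion (B s : ℝ) (c : List ℕ) : ℝ :=
  (c.countP fun x : ℕ => significand B (x : ℝ) ≤ s) / (c.length : ℝ)

/-- Finite collections of stick lengths form a countable set; every subset is an event. -/
instance instMeasurableSpaceListNat : MeasurableSpace (List ℕ) := ⊤

/-- A sequence of random finite collections of positive integers, given through its laws `p k`,
converges to strong Benford behavior in base `B`: for every `s ∈ [1, B)`, the expectation of the
proportion `P_k(s)` of entries with significand at most `s` tends to `log_B s`, and the variance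
of `P_k(s)` tends to `0`. -/
def ConvergesToStrongBenford (B : ℝ) (p : ℕ → PMF (List ℕ)) : Prop :=
  ∀ s ∈ Set.Ico 1 B,
    Tendsto (fun k => ∫ c, proportion B s c ∂(p k).toMeasure) atTop (𝓝 (Real.logb B s)) ∧
    Tendsto (fun k => variance (proportion B s) (p k).toMeasure) atTop (𝓝 0)

/-- The positive integers that are `1` or have residue modulo `n` in `S`. -/
def stoppingSet (n : ℕ) (S : Finset ℕ) : Set ℕ :=
  {1} ∪ {m | 0 < m ∧ ∃ r ∈ S, ∃ q : ℤ, (m : ℤ) = q * n + r}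

/-- A stick of integer length `l` is alive (it goes on breaking) if `l` is not in the stopping set
`T`. (A stick of length less than `2` has no interior integer point to be cut at; this is only
relevant for sets `T` without the element `1`.) -/
def Alive (T : Set ℕ) (l : ℕ) : Prop := l ∉ T ∧ 2 ≤ l

theorem Ico_nonempty_of_alive {T : Set ℕ} {l : ℕ} (h : Alive T l) : (Finset.Ico 1 l).Nonempty :=
  Finset.nonempty_Ico.2 h.2

open Classical in
/-- What happens to one stick of length `l` in one level: if it is alive, it is cut at a uniformly
distributed integer point `x ∈ {1, …, l - 1}` into pieces of lengths `x` and `l - x`; if it is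
dead, it is kept as it is. -/
noncomputable def breakStick (T : Set ℕ) (l : ℕ) : PMF (List ℕ) :=
  if h : Alive T l then
    (PMF.uniformOfFinset (Finset.Ico 1 l) (Ico_nonempty_of_alive h)).map fun x => [x, l - x]
  else PMF.pure [l]

/-- One level: all sticks of the collection are treated by `breakStick`, independently. -/
noncomputable def levelStep (T : Set ℕ) : List ℕ → PMF (List ℕ)
  | [] => PMF.pure []
  | l :: c => (breakStick T l).bind fun a => (levelStep T c).map fun b => a ++ b

/-- The law of the collection of all sticks, dead or alive, that are present after `N` levels, for
the process with stopping set `T` that starts from the collection `c`. -/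
noncomputable def fragmentation (T : Set ℕ) (c : List ℕ) : ℕ → PMF (List ℕ)
  | 0 => PMF.pure c
  | N + 1 => (fragmentation T c N).bind (levelStep T)

/-- The law of the collection of ending stick lengths, for the process with stopping set `T` that
starts from `R` sticks of length `L`. Every breaking shortens the pieces, so that all sticks are
dead after `L` levels, and later levels change nothing: see `not_alive_of_mem_endingLaw` and
`fragmentation_eq_endingLaw`. -/
noncomputable def endingLaw (T : Set ℕ) (L R : ℕ) : PMF (List ℕ) :=
  fragmentation T (List.replicate R L) L

theorem of_mem_breakStick {T : Set ℕ} {l : ℕ} {a : List ℕ} (ha : a ∈ (breakStick T l).support)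
    {x : ℕ} (hx : x ∈ a) : (x = l ∧ ¬ Alive T l) ∨ x < l := by
  classical
  unfold breakStick at ha
  split_ifs at ha with h
  · simp only [PMF.mem_support_map_iff, PMF.mem_support_uniformOfFinset_iff, Finset.mem_Ico] at ha
    obtain ⟨y, ⟨h1, h2⟩, rfl⟩ := ha
    simp only [List.mem_cons, List.not_mem_nil, or_false] at hx
    omega
  · simp only [PMF.mem_support_pure_iff] at ha
    subst ha
    simp only [List.mem_cons, List.not_mem_nil, or_false] at hx
    exact Or.inl ⟨hx, h⟩

theorem of_mem_levelStep {T : Set ℕ} {c d : List ℕ} (hd : d ∈ (levelStep T c).support)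
    {x : ℕ} (hx : x ∈ d) : (x ∈ c ∧ ¬ Alive T x) ∨ ∃ l ∈ c, Alive T l ∧ x < l := by
  classical
  induction c generalizing d with
  | nil =>
    simp only [levelStep, PMF.mem_support_pure_iff] at hd
    subst hd
    simp at hx
  | cons l c ih =>
    simp only [levelStep, PMF.mem_support_bind_iff, PMF.mem_support_map_iff] at hd
    obtain ⟨a, ha, b, hb, rfl⟩ := hd
    rcases List.mem_append.1 hx with hx | hx
    · by_cases hl : Alive T l
      · rcases of_mem_breakStick ha hx with h | h
        · exact absurd hl h.2
        · exact Or.inr ⟨l, by simp, hl, h⟩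
      · unfold breakStick at ha
        rw [dif_neg hl, PMF.mem_support_pure_iff] at ha
        subst ha
        obtain rfl : x = l := by simpa using hx
        exact Or.inl ⟨by simp, hl⟩
    · rcases ih hb hx with h | ⟨m, hm, h⟩
      · exact Or.inl ⟨by simp [h.1], h.2⟩
      · exact Or.inr ⟨m, by simp [hm], h⟩

theorem add_le_of_mem_fragmentation {T : Set ℕ} {L R N : ℕ} {d : List ℕ}
    (hd : d ∈ (fragmentation T (List.replicate R L) N).support) {x : ℕ} (hx : x ∈ d)
    (hxT : Alive T x) : x + N ≤ L := by
  induction N generalizing d x with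
  | zero =>
    simp only [fragmentation, PMF.mem_support_pure_iff] at hd
    subst hd
    exact (List.eq_of_mem_replicate hx).le
  | succ N ih =>
    simp only [fragmentation, PMF.mem_support_bind_iff] at hd
    obtain ⟨c, hc, hd⟩ := hd
    rcases of_mem_levelStep hd hx with h | ⟨l, hl, hlT, h⟩
    · exact absurd hxT h.2
    · have := ih hc hl hlT
      omega

/-- All ending sticks are dead. -/
theorem not_alive_of_mem_endingLaw {T : Set ℕ} {L R : ℕ} {d : List ℕ}
    (hd : d ∈ (endingLaw T L R).support) {x : ℕ} (hx : x ∈ d) : ¬ Alive T x := fun hxT => by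
  have h := add_le_of_mem_fragmentation hd hx hxT
  have := hxT.2
  omega

theorem levelStep_eq_pure {T : Set ℕ} {c : List ℕ} (hc : ∀ x ∈ c, ¬ Alive T x) :
    levelStep T c = PMF.pure c := by
  induction c with
  | nil => rfl
  | cons l c ih =>
    rw [levelStep, ih fun x hx => hc x (by simp [hx]), breakStick, dif_neg (hc l (by simp)),
      PMF.pure_bind, PMF.pure_map]
    rfl

/-- Nothing changes after level `L`. -/
theorem fragmentation_eq_endingLaw (T : Set ℕ) (L R N : ℕ) :
    fragmentation T (List.replicate R L) (L + N) = endingLaw T L R := by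
  induction N with
  | zero => rfl
  | succ N ih =>
    rw [← Nat.add_assoc, fragmentation, ih]
    conv_rhs => rw [← PMF.bind_pure (endingLaw T L R)]
    ext d
    rw [PMF.bind_apply, PMF.bind_apply]
    refine tsum_congr fun c => ?_
    by_cases hc : c ∈ (endingLaw T L R).support
    · rw [levelStep_eq_pure fun x hx => not_alive_of_mem_endingLaw hc hx]
    · rw [(PMF.apply_eq_zero_iff _ _).2 hc, zero_mul, zero_mul]

end StickFragmentation

/-! The problem is linear in the collection of sticks. The expected sum over the ending sticks of a
function `f`, from one stick of length `l`, is `moment T (onDead T f) l`; it satisfies a recursion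
in which a living length `m` contributes the mean of the values at smaller lengths, doubled. The
partial sums of a solution obey a first-order recursion with integrating factor `growth`, so the
solution is explicit: `2 * growth T l / (l - 1)` times `sourceSum`.

Everything then rests on `growth T m ~ c * m` (`exists_tendsto_growth_div`). By `growth_mul_prod`
this is the convergence of an infinite product of factors `1 - aliveSign / y`, hence of a series of
signs over `y`; Dirichlet's test applies because half of the residues are dead. By
`sourceSum_onDead_one` the dead lengths between `u` and `v` then contribute about `log (v / u) / (2
* c)` to `sourceSum`, whatever the set of residues. Applied to `[B ^ k, s * B ^ k]` and summed over
`k`, this shows that the expected number of ending sticks with significand at most `s` is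
asymptotically `log_B s` times the expected number of all ending sticks, which is asymptotic to `log
L` for one initial stick.

For concentration, `total M` with `M = moment T (onDead T f)` is a martingale over the levels. Its
increments are controlled by a second solution of the recursion, with a source of order `log ^ 2`
(`exists_integral_endingLaw_sq_le`), which bounds the variance by a multiple of `R * (1 + log L) ^
3`. Against the squared mean count, of order `(R * log L) ^ 2`, this is negligible. The random
denominator of the proportion is removed by `sq_proportion_sub_le`. -/

/-! ### Integration against finitely supported laws -/

theorem PMF.integrable_of_finite_support {α : Type*} [MeasurableSpace α]
    [MeasurableSingletonClass α] {p : PMF α} (hp : p.support.Finite) (f : α → ℝ) :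
    Integrable f p.toMeasure := by
  have h : IntegrableOn f p.support p.toMeasure := by
    have hU : p.support = ⋃ i ∈ hp.toFinset, {i} := by
      ext
      simp
    rw [hU, integrableOn_finset_iUnion]
    intro i _
    exact integrableOn_singleton (by simp)
  rwa [IntegrableOn, PMF.restrict_toMeasure_support] at h

theorem PMF.integral_eq_sum_of_support_subset {α : Type*} [MeasurableSpace α]
    [MeasurableSingletonClass α] {p : PMF α} {s : Finset α} (hp : p.support ⊆ s) (f : α → ℝ) :
    ∫ a, f a ∂p.toMeasure = ∑ a ∈ s, (p a).toReal * f a := by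
  rw [PMF.integral_eq_tsum _ _ (PMF.integrable_of_finite_support (s.finite_toSet.subset hp) f),
    tsum_eq_sum (s := s)]
  · rfl
  · intro a ha
    rw [(p.apply_eq_zero_iff a).2 fun h => ha (hp h)]
    simp

theorem PMF.finite_support_bind {α β : Type*} {p : PMF α} {q : α → PMF β}
    (hp : p.support.Finite) (hq : ∀ a, (q a).support.Finite) : (p.bind q).support.Finite := by
  rw [PMF.support_bind]
  exact hp.biUnion fun a _ => hq a

theorem PMF.finite_support_map {α β : Type*} {p : PMF α} (hp : p.support.Finite) (f : α → β) :
    (p.map f).support.Finite := by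
  rw [PMF.support_map]
  exact hp.image f

theorem PMF.finite_support_pure {α : Type*} (a : α) : (PMF.pure a).support.Finite := by
  rw [PMF.support_pure]
  exact Set.finite_singleton a

theorem PMF.integral_bind {α β : Type*} [MeasurableSpace α] [MeasurableSingletonClass α]
    [MeasurableSpace β] [MeasurableSingletonClass β] {p : PMF α} {q : α → PMF β}
    (hp : p.support.Finite) (hq : ∀ a, (q a).support.Finite) (f : β → ℝ) :
    ∫ b, f b ∂(p.bind q).toMeasure = ∫ a, ∫ b, f b ∂(q a).toMeasure ∂p.toMeasure := by
  have hpq := PMF.finite_support_bind hp hq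
  have hsub : ∀ a ∈ hp.toFinset, (q a).support ⊆ hpq.toFinset := by
    intro a ha b hb
    simp only [Set.Finite.coe_toFinset, PMF.mem_support_bind_iff]
    exact ⟨a, by simpa using ha, hb⟩
  rw [PMF.integral_eq_sum_of_support_subset (s := hpq.toFinset) (by simp),
    PMF.integral_eq_sum_of_support_subset (s := hp.toFinset) (by simp)]
  have hb : ∀ b, (p.bind q b).toReal = ∑ a ∈ hp.toFinset, (p a).toReal * (q a b).toReal := by
    intro b
    rw [PMF.bind_apply, tsum_eq_sum (s := hp.toFinset), ENNReal.toReal_sum]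
    · simp
    · intro a _
      exact ENNReal.mul_ne_top (p.apply_ne_top a) ((q a).apply_ne_top b)
    · intro a ha
      rw [(p.apply_eq_zero_iff a).2 (by simpa using ha), zero_mul]
  simp only [hb, Finset.sum_mul]
  rw [Finset.sum_comm]
  refine Finset.sum_congr rfl fun a ha => ?_
  rw [PMF.integral_eq_sum_of_support_subset (hsub a ha), Finset.mul_sum]
  exact Finset.sum_congr rfl fun b _ => mul_assoc _ _ _

theorem PMF.integral_pure {α : Type*} [MeasurableSpace α] [MeasurableSingletonClass α] (a : α)
    (f : α → ℝ) : ∫ b, f b ∂(PMF.pure a).toMeasure = f a := by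
  rw [PMF.integral_eq_sum_of_support_subset (s := {a}) (by simp)]
  simp

theorem PMF.integral_map {α β : Type*} [MeasurableSpace α] [MeasurableSingletonClass α]
    [MeasurableSpace β] [MeasurableSingletonClass β] {p : PMF α}
    (hp : p.support.Finite) (g : α → β) (f : β → ℝ) :
    ∫ b, f b ∂(p.map g).toMeasure = ∫ a, f (g a) ∂p.toMeasure := by
  rw [← PMF.bind_pure_comp, PMF.integral_bind (q := PMF.pure ∘ g) hp fun a => PMF.finite_support_pure (g a)]
  simp only [Function.comp, PMF.integral_pure]

theorem PMF.integral_mono_of_finite_support {α : Type*} [MeasurableSpace α]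
    [MeasurableSingletonClass α] {p : PMF α} (hp : p.support.Finite) {f g : α → ℝ}
    (h : ∀ a ∈ p.support, f a ≤ g a) : ∫ a, f a ∂p.toMeasure ≤ ∫ a, g a ∂p.toMeasure := by
  rw [PMF.integral_eq_sum_of_support_subset (s := hp.toFinset) (by simp),
    PMF.integral_eq_sum_of_support_subset (s := hp.toFinset) (by simp)]
  exact Finset.sum_le_sum fun a ha =>
    mul_le_mul_of_nonneg_left (h a (by simpa using ha)) ENNReal.toReal_nonneg

/-! ### Additive functionals: first and second moments over one level -/

namespace StickFragmentation

instance instMeasurableSingletonClassListNat : MeasurableSingletonClass (List ℕ) :=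
  ⟨fun _ => trivial⟩

/-- The additive functional of collections of sticks that is `f` on a single stick. -/
def total (f : ℕ → ℝ) (c : List ℕ) : ℝ := (c.map f).sum

theorem total_nil (f : ℕ → ℝ) : total f [] = 0 := rfl

theorem total_cons (f : ℕ → ℝ) (l : ℕ) (c : List ℕ) : total f (l :: c) = f l + total f c := by
  simp [total]

theorem total_append (f : ℕ → ℝ) (c d : List ℕ) : total f (c ++ d) = total f c + total f d := by
  simp [total]

theorem total_replicate (f : ℕ → ℝ) (R l : ℕ) : total f (List.replicate R l) = R * f l := by
  simp [total]

theorem finite_support_breakStick (T : Set ℕ) (l : ℕ) : (breakStick T l).support.Finite := by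
  unfold breakStick
  split_ifs with h
  · refine PMF.finite_support_map ?_ _
    rw [PMF.support_uniformOfFinset]
    exact Finset.finite_toSet _
  · exact PMF.finite_support_pure _

theorem finite_support_levelStep (T : Set ℕ) (c : List ℕ) : (levelStep T c).support.Finite := by
  induction c with
  | nil => exact PMF.finite_support_pure _
  | cons l c ih =>
    exact PMF.finite_support_bind (finite_support_breakStick T l)
      fun a => PMF.finite_support_map ih _

theorem finite_support_fragmentation (T : Set ℕ) (c : List ℕ) (N : ℕ) :
    (fragmentation T c N).support.Finite := by
  induction N with
  | zero => exact PMF.finite_support_pure _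
  | succ N ih => exact PMF.finite_support_bind ih (finite_support_levelStep T)

theorem integral_breakStick_of_alive {T : Set ℕ} {l : ℕ} (h : Alive T l) (f : List ℕ → ℝ) :
    ∫ a, f a ∂(breakStick T l).toMeasure =
      (∑ x ∈ Finset.Ico 1 l, f [x, l - x]) / ((l : ℝ) - 1) := by
  have hs := PMF.support_uniformOfFinset (Ico_nonempty_of_alive h)
  rw [breakStick, dif_pos h, PMF.integral_map (by rw [hs]; exact Finset.finite_toSet _),
    PMF.integral_eq_sum_of_support_subset (s := Finset.Ico 1 l) hs.le, Finset.sum_div]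
  refine Finset.sum_congr rfl fun x hx => ?_
  rw [PMF.uniformOfFinset_apply_of_mem _ hx, ENNReal.toReal_inv, ENNReal.toReal_natCast,
    Nat.card_Ico, Nat.cast_sub (by have := h.2; omega)]
  push_cast
  ring

theorem integral_breakStick_of_not_alive {T : Set ℕ} {l : ℕ} (h : ¬ Alive T l)
    (f : List ℕ → ℝ) : ∫ a, f a ∂(breakStick T l).toMeasure = f [l] := by
  rw [breakStick, dif_neg h, PMF.integral_pure]

theorem integral_levelStep_cons (T : Set ℕ) (l : ℕ) (c : List ℕ) (f : List ℕ → ℝ) :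
    ∫ d, f d ∂(levelStep T (l :: c)).toMeasure =
      ∫ a, ∫ b, f (a ++ b) ∂(levelStep T c).toMeasure ∂(breakStick T l).toMeasure := by
  rw [levelStep, PMF.integral_bind (finite_support_breakStick T l)
    fun a => PMF.finite_support_map (finite_support_levelStep T c) _]
  simp only [PMF.integral_map (finite_support_levelStep T c)]

theorem integral_levelStep_total (T : Set ℕ) (f : ℕ → ℝ) (c : List ℕ) :
    ∫ d, total f d ∂(levelStep T c).toMeasure =
      total (fun l => ∫ a, total f a ∂(breakStick T l).toMeasure) c := by
  induction c with
  | nil => simp [levelStep, PMF.integral_pure, total_nil]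
  | cons l c ih =>
    have h1 := PMF.integrable_of_finite_support (finite_support_levelStep T c)
    have h2 := PMF.integrable_of_finite_support (finite_support_breakStick T l)
    simp only [integral_levelStep_cons, total_append, total_cons]
    simp_rw [integral_add (h1 _) (h1 _), ih]
    rw [integral_add (h2 _) (h2 _)]
    simp

/-- If `M` is harmonic for the breaking of one stick, then the second moment of `total M` after
one level is the sum of its square and of the variances coming from the single sticks. -/
theorem integral_levelStep_sq {T : Set ℕ} {M : ℕ → ℝ}
    (hM : ∀ l, ∫ a, total M a ∂(breakStick T l).toMeasure = M l) (c : List ℕ) (t : ℝ) :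
    ∫ d, (total M d - t) ^ 2 ∂(levelStep T c).toMeasure = (total M c - t) ^ 2 +
      total (fun l => ∫ a, (total M a - M l) ^ 2 ∂(breakStick T l).toMeasure) c := by
  induction c generalizing t with
  | nil => simp [levelStep, PMF.integral_pure, total_nil]
  | cons l c ih =>
    have h2 := PMF.integrable_of_finite_support (finite_support_breakStick T l)
    -- The pieces of the first stick are absorbed into the centre `t`, so the induction hypothesis
    -- is needed for every `t`.
    have h3 : ∀ a b, (total M (a ++ b) - t) ^ 2 = (total M b - (t - total M a)) ^ 2 := by
      intro a b
      rw [total_append]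
      ring
    -- Apart from the variance term this is affine in `total M a`. Replacing `total M a` by its mean
    -- `M l` turns the affine part into `(M l + total M c - t) ^ 2`.
    have h4 : ∀ a, (total M c - (t - total M a)) ^ 2 =
        (total M a - M l) ^ 2 + (2 * (M l + total M c - t) * total M a
          + ((total M c - t) ^ 2 - M l ^ 2)) := by
      intro a
      ring
    simp only [integral_levelStep_cons, h3, ih, total_cons]
    rw [integral_add (h2 _) (h2 _)]
    simp_rw [h4]
    rw [integral_add (h2 _) (h2 _), integral_add (h2 _) (h2 _), integral_const_mul, hM]
    simp
    ring

/-- If `M` is harmonic and `Q` dominates the expected value of `Q` on the pieces plus the variance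
of `M` on the pieces, then `(total M - t) ^ 2 + total Q` is a supermartingale. -/
theorem integral_fragmentation_le {T : Set ℕ} {M Q : ℕ → ℝ}
    (hM : ∀ l, ∫ a, total M a ∂(breakStick T l).toMeasure = M l)
    (hQ : ∀ l, ∫ a, (total M a - M l) ^ 2 ∂(breakStick T l).toMeasure +
      ∫ a, total Q a ∂(breakStick T l).toMeasure ≤ Q l) (c : List ℕ) (N : ℕ) (t : ℝ) :
    ∫ d, ((total M d - t) ^ 2 + total Q d) ∂(fragmentation T c N).toMeasure ≤
      (total M c - t) ^ 2 + total Q c := by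
  induction N with
  | zero => simp [fragmentation, PMF.integral_pure]
  | succ N ih =>
    refine le_trans ?_ ih
    rw [fragmentation, PMF.integral_bind (finite_support_fragmentation T c N)
      (finite_support_levelStep T)]
    refine PMF.integral_mono_of_finite_support (finite_support_fragmentation T c N) fun d _ => ?_
    have h1 := PMF.integrable_of_finite_support (finite_support_levelStep T d)
    rw [integral_add (h1 _) (h1 _), integral_levelStep_sq hM, integral_levelStep_total, add_assoc,
      add_le_add_iff_left]
    simp only [total]
    rw [← List.sum_map_add]
    exact List.sum_le_sum fun l _ => hQ l

/-! ### Explicit solution of the fragmentation recursion -/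

open Classical in
/-- The factor by which the expected number of sticks grows at the length `y`, multiplied over all
lengths less than `m`. -/
noncomputable def growth (T : Set ℕ) (m : ℕ) : ℝ :=
  ∏ y ∈ Finset.Ico 1 m, if Alive T y then ((y : ℝ) + 1) / (y - 1) else 1

open Classical in
/-- `1` on living lengths and `-1` on dead lengths. -/
noncomputable def aliveSign (T : Set ℕ) (y : ℕ) : ℝ := if Alive T y then 1 else -1

open Classical in
/-- The restriction of `f` to the dead lengths. -/
noncomputable def onDead (T : Set ℕ) (f : ℕ → ℝ) (y : ℕ) : ℝ := if Alive T y then 0 else f y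

/-- The weighted sum that gives the solution of the fragmentation recursion with source `g`. -/
noncomputable def sourceSum (T : Set ℕ) (g : ℕ → ℝ) (m : ℕ) : ℝ :=
  ∑ x ∈ Finset.Ico 1 m, g x / growth T (x + 1)

open Classical in
/-- The solution of the fragmentation recursion with source `g`. -/
noncomputable def moment (T : Set ℕ) (g : ℕ → ℝ) (l : ℕ) : ℝ :=
  g l + if Alive T l then 2 * growth T l / (l - 1) * sourceSum T g l else 0

theorem one_lt_of_alive {T : Set ℕ} {m : ℕ} (h : Alive T m) : (1 : ℝ) < m := by
  exact_mod_cast h.2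

theorem growth_succ_of_alive {T : Set ℕ} {m : ℕ} (h : Alive T m) :
    growth T (m + 1) = growth T m * (((m : ℝ) + 1) / (m - 1)) := by
  rw [growth, Finset.prod_Ico_succ_top (by have := h.2; omega), if_pos h, growth]

theorem growth_succ_of_not_alive {T : Set ℕ} {m : ℕ} (hm : 1 ≤ m) (h : ¬ Alive T m) :
    growth T (m + 1) = growth T m := by
  rw [growth, Finset.prod_Ico_succ_top hm, if_neg h, growth, mul_one]

theorem growth_pos (T : Set ℕ) (m : ℕ) : 0 < growth T m := by
  refine Finset.prod_pos fun y _ => ?_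
  split_ifs with h
  · have := one_lt_of_alive h
    exact div_pos (by linarith) (by linarith)
  · exact one_pos

/-- Each step multiplies the left side by `(m + 1) / m`: at a living length as `(m + 1) / (m - 1) *
(1 - 1 / m)`, at a dead one as `1 + 1 / m`. The asymptotics of `growth` thus become a question about
a product with factors near `1`. -/
theorem growth_mul_prod (T : Set ℕ) {m : ℕ} (hm : 1 ≤ m) :
    growth T m * ∏ y ∈ Finset.Ico 1 m, (1 - aliveSign T y / y) = m := by
  induction m, hm using Nat.le_induction with
  | base => simp [growth]
  | succ m hm ih =>
    have h0 : (0 : ℝ) < m := by exact_mod_cast hm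
    rw [Finset.prod_Ico_succ_top hm]
    by_cases h : Alive T m
    · have h1 := one_lt_of_alive h
      rw [growth_succ_of_alive h, aliveSign, if_pos h]
      have h2 : (m : ℝ) - 1 ≠ 0 := by linarith
      calc _ = (growth T m * ∏ y ∈ Finset.Ico 1 m, (1 - aliveSign T y / y)) *
            (((m : ℝ) + 1) / (m - 1) * (1 - 1 / m)) := by ring
        _ = _ := by
          rw [ih]
          push_cast
          field_simp
    · rw [growth_succ_of_not_alive hm h, aliveSign, if_neg h, ← mul_assoc, ih]
      push_cast
      field_simp
      ring

theorem sourceSum_succ (T : Set ℕ) (g : ℕ → ℝ) {m : ℕ} (hm : 1 ≤ m) :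
    sourceSum T g (m + 1) = sourceSum T g m + g m / growth T (m + 1) :=
  Finset.sum_Ico_succ_top hm _

/-- `growth` is the integrating factor: the partial sums satisfy `A (m + 1) = (1 + 2 / (m - 1)) * A
m + g m` at a living `m`, where `1 + 2 / (m - 1) = (m + 1) / (m - 1)`, and `A (m + 1) = A m + g m`
at a dead `m`. -/
theorem sum_moment (T : Set ℕ) (g : ℕ → ℝ) {m : ℕ} (hm : 1 ≤ m) :
    ∑ x ∈ Finset.Ico 1 m, moment T g x = growth T m * sourceSum T g m := by
  induction m, hm using Nat.le_induction with
  | base => simp [sourceSum]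
  | succ m hm ih =>
    have h3 := growth_pos T (m + 1)
    have h4 := growth_pos T m
    rw [Finset.sum_Ico_succ_top hm, ih, sourceSum_succ T g hm, mul_add,
      mul_div_cancel₀ _ h3.ne', moment]
    by_cases h : Alive T m
    · have h1 := one_lt_of_alive h
      have h2 : (m : ℝ) - 1 ≠ 0 := by linarith
      rw [growth_succ_of_alive h, if_pos h]
      field_simp
      ring
    · rw [growth_succ_of_not_alive hm h, if_neg h]
      ring

theorem moment_of_alive {T : Set ℕ} (g : ℕ → ℝ) {l : ℕ} (h : Alive T l) :
    moment T g l = g l + 2 * (∑ x ∈ Finset.Ico 1 l, moment T g x) / ((l : ℝ) - 1) := by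
  rw [sum_moment T g (by have := h.2; omega), moment, if_pos h]
  ring

theorem moment_of_not_alive {T : Set ℕ} (g : ℕ → ℝ) {l : ℕ} (h : ¬ Alive T l) :
    moment T g l = g l := by
  rw [moment, if_neg h, add_zero]

theorem sum_moment_add (T : Set ℕ) (g : ℕ → ℝ) (l : ℕ) :
    ∑ x ∈ Finset.Ico 1 l, (moment T g x + moment T g (l - x)) =
      2 * ∑ x ∈ Finset.Ico 1 l, moment T g x := by
  rw [Finset.sum_add_distrib, two_mul, add_right_inj]
  refine Finset.sum_nbij' (fun x => l - x) (fun x => l - x) ?_ ?_ ?_ ?_ ?_ <;>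
    simp only [Finset.mem_Ico, implies_true] <;> intros <;> omega

/-- The increment of `m / growth T m` is `1 / growth T m` at a dead length and minus that at a
living one. Hence the sum over dead lengths is half the sum over all lengths plus a telescoping
term, which removes the dependence on which residues are dead. -/
theorem sourceSum_onDead_one (T : Set ℕ) {m : ℕ} (hm : 1 ≤ m) :
    sourceSum T (onDead T 1) m =
      (∑ x ∈ Finset.Ico 1 m, 1 / growth T x) / 2 + m / growth T m / 2 - 1 / 2 := by
  induction m, hm using Nat.le_induction with
  | base => simp [sourceSum, growth]
  | succ m hm ih =>
    have h4 := growth_pos T m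
    have h0 : (0 : ℝ) < m := by exact_mod_cast hm
    rw [sourceSum_succ T _ hm, Finset.sum_Ico_succ_top hm, ih, onDead]
    by_cases h : Alive T m
    · have h1 := one_lt_of_alive h
      have h2 : (m : ℝ) - 1 ≠ 0 := by linarith
      rw [growth_succ_of_alive h, if_pos h]
      push_cast
      field_simp
      ring
    · rw [growth_succ_of_not_alive hm h, if_neg h]
      push_cast
      simp only [Pi.one_apply]
      field_simp
      ring

theorem abs_aliveSign (T : Set ℕ) (y : ℕ) : |aliveSign T y| = 1 := by
  unfold aliveSign
  split_ifs <;> simp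

/-! ### Linear growth -/

/-- If the living lengths have density `1 / 2` with bounded discrepancy, then `growth` grows
linearly. -/
theorem exists_tendsto_growth_div {T : Set ℕ} {b : ℝ}
    (hb : ∀ m, |∑ i ∈ Finset.range m, aliveSign T (i + 1)| ≤ b) :
    ∃ c > 0, Tendsto (fun m : ℕ => growth T m / m) atTop (𝓝 c) := by
  have hpos : ∀ i : ℕ, 0 < 1 - aliveSign T (i + 1) / ((i : ℝ) + 1) := by
    intro i
    unfold aliveSign
    split_ifs with h
    · have := one_lt_of_alive h
      push_cast at this
      rw [sub_pos, div_lt_one (by linarith)]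
      exact this
    · have : (0 : ℝ) < (i : ℝ) + 1 := by positivity
      rw [neg_div, sub_neg_eq_add]
      positivity
  -- Dirichlet's test: bounded partial sums of signs against the decreasing weights `1 / (i + 1)`.
  obtain ⟨a₁, h₁⟩ : ∃ a, Tendsto (fun m => ∑ i ∈ Finset.range m,
      (1 / ((i : ℝ) + 1)) • aliveSign T (i + 1)) atTop (𝓝 a) := by
    refine cauchySeq_tendsto_of_complete
      (Antitone.cauchySeq_series_mul_of_tendsto_zero_of_bounded (b := b) ?_
        tendsto_one_div_add_atTop_nhds_zero_nat hb)
    intro i j hij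
    exact one_div_le_one_div_of_le (by positivity) (by gcongr)
  have h₂ : Summable fun i : ℕ => aliveSign T (i + 1) / ((i : ℝ) + 1) +
      Real.log (1 - aliveSign T (i + 1) / ((i : ℝ) + 1)) := by
    have hs : Summable fun i : ℕ => 2 * (1 / ((i + 1 : ℕ) : ℝ) ^ 2) :=
      ((summable_nat_add_iff 1).2 (Real.summable_one_div_nat_pow.2 one_lt_two)).mul_left 2
    refine Summable.of_norm_bounded_eventually_nat hs ?_
    -- At `i = 0` the quotient has absolute value `1`. From `i = 1` on, `|x| ≤ 1 / 2`, so the Taylor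
    -- remainder `|x| ^ 2 / (1 - |x|)` is at most `2 * |x| ^ 2`.
    filter_upwards [eventually_ge_atTop 1] with i hi
    have hi' : (1 : ℝ) ≤ i := by exact_mod_cast hi
    set x := aliveSign T (i + 1) / ((i : ℝ) + 1) with hx
    have hxa : |x| = 1 / ((i : ℝ) + 1) := by
      rw [hx, abs_div, abs_aliveSign, abs_of_pos (by positivity : (0 : ℝ) < (i : ℝ) + 1)]
    have hx2 : |x| ≤ 1 / 2 := by
      rw [hxa]
      exact one_div_le_one_div_of_le two_pos (by linarith)
    have := Real.abs_log_sub_add_sum_range_le (by linarith : |x| < 1) 1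
    simp only [Finset.sum_range_one, zero_add, pow_one, Nat.cast_zero, div_one] at this
    rw [Real.norm_eq_abs]
    refine this.trans ?_
    rw [div_le_iff₀ (by linarith)]
    push_cast
    rw [← one_div_pow, ← hxa]
    nlinarith [sq_nonneg |x|]
  have h₃ := (h₂.hasSum.tendsto_sum_nat.sub h₁).rexp
  set a := Real.exp (∑' i : ℕ, (aliveSign T (i + 1) / ((i : ℝ) + 1) +
      Real.log (1 - aliveSign T (i + 1) / ((i : ℝ) + 1))) - a₁) with ha
  have ha0 : 0 < a := Real.exp_pos _
  refine ⟨a⁻¹, inv_pos.2 ha0, ?_⟩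
  rw [← tendsto_add_atTop_iff_nat 1]
  refine (h₃.inv₀ ha0.ne').congr fun m => ?_
  have hg := growth_mul_prod T (Nat.le_add_left 1 m)
  rw [Finset.prod_Ico_eq_prod_range] at hg
  have he : Real.exp (∑ i ∈ Finset.range m, (aliveSign T (i + 1) / ((i : ℝ) + 1) +
      Real.log (1 - aliveSign T (i + 1) / ((i : ℝ) + 1))) -
      ∑ i ∈ Finset.range m, (1 / ((i : ℝ) + 1)) • aliveSign T (i + 1)) =
      ∏ i ∈ Finset.range m, (1 - aliveSign T (i + 1) / ((i : ℝ) + 1)) := by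
    rw [← Finset.sum_sub_distrib, Real.exp_sum]
    refine Finset.prod_congr rfl fun i _ => ?_
    rw [smul_eq_mul, show ∀ x y z : ℝ, x / y + z - 1 / y * x = z by intros; ring,
      Real.exp_log (hpos i)]
  rw [he]
  have hp : ∏ i ∈ Finset.range m, (1 - aliveSign T (i + 1) / ((i : ℝ) + 1)) ≠ 0 :=
    Finset.prod_ne_zero_iff.2 fun i _ => (hpos i).ne'
  rw [← hg]
  have hp' : ∏ k ∈ Finset.range (m + 1 - 1), (1 - aliveSign T (1 + k) / ((1 + k : ℕ) : ℝ)) =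
      ∏ i ∈ Finset.range m, (1 - aliveSign T (i + 1) / ((i : ℝ) + 1)) := by
    refine Finset.prod_congr rfl fun i _ => ?_
    rw [add_comm 1 i]
    push_cast
    rfl
  rw [hp']
  have := (growth_pos T (m + 1)).ne'
  field_simp

theorem exists_growth_bounds {T : Set ℕ} {c : ℝ} (hc0 : 0 < c)
    (hc : Tendsto (fun m : ℕ => growth T m / m) atTop (𝓝 c)) :
    ∃ C : ℝ, 0 < C ∧ ∀ m : ℕ, 1 ≤ m → growth T m ≤ C * m ∧ m ≤ C * growth T m := by
  obtain ⟨C₁, h₁⟩ := hc.bddAbove_range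
  obtain ⟨C₂, h₂⟩ := (hc.inv₀ hc0.ne').bddAbove_range
  refine ⟨max 1 (max C₁ C₂), by positivity, fun m hm => ?_⟩
  have hm0 : (0 : ℝ) < m := by exact_mod_cast hm
  have hg := growth_pos T m
  have h₃ : growth T m / m ≤ C₁ := h₁ ⟨m, rfl⟩
  have h₄ : (growth T m / m)⁻¹ ≤ C₂ := h₂ ⟨m, rfl⟩
  rw [inv_div] at h₄
  rw [div_le_iff₀ hm0] at h₃
  rw [div_le_iff₀ hg] at h₄
  constructor
  · exact h₃.trans (by gcongr; exact (le_max_left _ _).trans (le_max_right _ _))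
  · exact h₄.trans (by gcongr; exact (le_max_right _ _).trans (le_max_right _ _))

/-! ### Harmonic sums and logarithmic bounds -/

theorem sum_Ico_one_div_eq_harmonic (m : ℕ) :
    ∑ x ∈ Finset.Ico 1 m, 1 / (x : ℝ) = (harmonic (m - 1) : ℝ) := by
  rw [Finset.sum_Ico_eq_sum_range, harmonic]
  push_cast
  refine Finset.sum_congr rfl fun i _ => ?_
  rw [one_div, add_comm]

theorem sum_Ico_one_div_le {m : ℕ} (hm : 1 ≤ m) :
    ∑ x ∈ Finset.Ico 1 m, 1 / (x : ℝ) ≤ 1 + Real.log m := by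
  rw [sum_Ico_one_div_eq_harmonic]
  refine (harmonic_le_one_add_log _).trans ?_
  rcases Nat.eq_or_lt_of_le hm with rfl | h
  · simp
  · have h1 : (0 : ℝ) < ((m - 1 : ℕ) : ℝ) := by
      exact_mod_cast (by omega : 0 < m - 1)
    have h2 : ((m - 1 : ℕ) : ℝ) ≤ m := by exact_mod_cast Nat.sub_le m 1
    have := Real.log_le_log h1 h2
    linarith

theorem tendsto_sum_Ico_one_div_sub_log :
    Tendsto (fun m : ℕ => ∑ x ∈ Finset.Ico 1 m, 1 / (x : ℝ) - Real.log m) atTop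
      (𝓝 Real.eulerMascheroniConstant) := by
  rw [← tendsto_add_atTop_iff_nat 1]
  refine Real.tendsto_harmonic_sub_log_add_one.congr fun m => ?_
  rw [sum_Ico_one_div_eq_harmonic]
  simp

/-- A bounded source gives at most a logarithmic solution, since `1 / growth` is comparable with `1
/ x` and the prefactor `2 * growth T l / (l - 1)` is bounded. The constant is uniform in `g`,
because the bound is applied both to the means and to the variance source. -/
theorem exists_abs_moment_le {T : Set ℕ} {c : ℝ} (hc0 : 0 < c)
    (hc : Tendsto (fun m : ℕ => growth T m / m) atTop (𝓝 c)) :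
    ∃ K : ℝ, 0 < K ∧ ∀ (g : ℕ → ℝ) (G : ℝ) (l : ℕ), 1 ≤ l →
      (∀ x, 1 ≤ x → x ≤ l → |g x| ≤ G) → |moment T g l| ≤ G * (K * (1 + Real.log l)) := by
  obtain ⟨C, hC0, hC⟩ := exists_growth_bounds hc0 hc
  refine ⟨1 + 4 * C * C, by positivity, fun g G l hl hg => ?_⟩
  have hG : 0 ≤ G := (abs_nonneg _).trans (hg l hl le_rfl)
  have hlog : 0 ≤ Real.log l := Real.log_nonneg (by exact_mod_cast hl)
  have h1 : |sourceSum T g l| ≤ G * C * (1 + Real.log l) := by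
    refine (Finset.abs_sum_le_sum_abs _ _).trans ?_
    refine le_trans ?_ (mul_le_mul_of_nonneg_left (sum_Ico_one_div_le hl) (by positivity))
    rw [Finset.mul_sum]
    refine Finset.sum_le_sum fun x hx => ?_
    rw [Finset.mem_Ico] at hx
    have hx0 : (0 : ℝ) < x := by exact_mod_cast hx.1
    have hgr := growth_pos T (x + 1)
    have h2 := (hC (x + 1) (by omega)).2
    push_cast at h2
    rw [abs_div, abs_of_pos hgr, mul_one_div, div_le_div_iff₀ hgr hx0]
    have h3 := hg x hx.1 hx.2.le
    calc |g x| * x ≤ G * (C * growth T (x + 1)) :=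
          mul_le_mul h3 (by linarith) hx0.le hG
      _ = _ := by ring
  have h2 : |moment T g l - g l| ≤ 4 * C * (G * C * (1 + Real.log l)) := by
    rw [moment, add_sub_cancel_left]
    split_ifs with h
    -- The factor `4 * C` comes from `growth T l ≤ C * l` and `l ≤ 2 * (l - 1)`.
    · have h5 : (2 : ℝ) ≤ l := by exact_mod_cast h.2
      rw [abs_mul]
      refine mul_le_mul ?_ h1 (abs_nonneg _) (by positivity)
      rw [abs_of_nonneg (div_nonneg (by linarith [growth_pos T l]) (by linarith)),
        div_le_iff₀ (by linarith)]
      have := (hC l hl).1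
      nlinarith
    · rw [abs_zero]
      positivity
  have h3 := hg l hl le_rfl
  have h4 : 0 ≤ G * Real.log l := by positivity
  calc |moment T g l| = |g l + (moment T g l - g l)| := by rw [add_sub_cancel]
    _ ≤ |g l| + |moment T g l - g l| := abs_add_le _ _
    _ ≤ G + 4 * C * (G * C * (1 + Real.log l)) := add_le_add h3 h2
    _ ≤ _ := by linarith

theorem tendsto_sum_Ico_one_div {u v : ℕ → ℕ} {t : ℝ} (ht : 0 < t) (hu : Tendsto u atTop atTop)
    (huv : ∀ k, u k ≤ v k) (hvu : Tendsto (fun k => (v k : ℝ) / u k) atTop (𝓝 t)) :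
    Tendsto (fun k => ∑ x ∈ Finset.Ico (u k) (v k), 1 / (x : ℝ)) atTop (𝓝 (Real.log t)) := by
  have hv : Tendsto v atTop atTop := tendsto_atTop_mono huv hu
  have h1 := (tendsto_sum_Ico_one_div_sub_log.comp hv).sub (tendsto_sum_Ico_one_div_sub_log.comp hu)
  have h2 := h1.add (hvu.log ht.ne')
  rw [sub_self, zero_add] at h2
  refine h2.congr' ?_
  filter_upwards [hu.eventually_ge_atTop 1] with k hk
  have h3 : (0 : ℝ) < u k := by exact_mod_cast hk
  have h4 : (0 : ℝ) < v k := by exact_mod_cast hk.trans (huv k)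
  rw [Real.log_div h4.ne' h3.ne']
  simp only [Function.comp]
  rw [← Finset.sum_Ico_consecutive _ hk (huv k)]
  ring

theorem tendsto_sum_Ico_one_div_growth {T : Set ℕ} {c : ℝ} (hc0 : 0 < c)
    (hc : Tendsto (fun m : ℕ => growth T m / m) atTop (𝓝 c))
    {u v : ℕ → ℕ} {t : ℝ} (ht : 0 < t) (hu : Tendsto u atTop atTop)
    (huv : ∀ k, u k ≤ v k) (hvu : Tendsto (fun k => (v k : ℝ) / u k) atTop (𝓝 t)) :
    Tendsto (fun k => ∑ x ∈ Finset.Ico (u k) (v k), 1 / growth T x) atTop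
      (𝓝 (c⁻¹ * Real.log t)) := by
  have hH := tendsto_sum_Ico_one_div ht hu huv hvu
  suffices h : Tendsto (fun k => ∑ x ∈ Finset.Ico (u k) (v k),
      (1 / growth T x - c⁻¹ * (1 / (x : ℝ)))) atTop (𝓝 0) by
    have h' := h.add (hH.const_mul c⁻¹)
    rw [zero_add] at h'
    refine h'.congr fun k => ?_
    rw [Finset.sum_sub_distrib, ← Finset.mul_sum, sub_add_cancel]
  rw [Metric.tendsto_atTop']
  intro ε hε
  -- The harmonic sum over the block is eventually below `|log t| + 1`, so a relative error `δ / 2`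
  -- per term costs less than `ε`.
  set δ := ε / (|Real.log t| + 1) with hδ
  have hδ0 : 0 < δ := by positivity
  obtain ⟨x₀, hx₀⟩ := (Metric.tendsto_atTop.1 (hc.inv₀ hc0.ne')) (δ / 2) (by positivity)
  have hev : ∀ᶠ k in atTop, x₀ ≤ u k ∧ 1 ≤ u k ∧
      ∑ x ∈ Finset.Ico (u k) (v k), 1 / (x : ℝ) < |Real.log t| + 1 :=
    (hu.eventually_ge_atTop x₀).and ((hu.eventually_ge_atTop 1).and
      (hH.eventually_lt_const (by linarith [le_abs_self (Real.log t)])))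
  obtain ⟨k₀, hk₀⟩ := eventually_atTop.1 hev
  refine ⟨k₀, fun k hk => ?_⟩
  obtain ⟨h1, h2, h3⟩ := hk₀ k hk.le
  rw [Real.dist_eq, sub_zero]
  calc _ ≤ ∑ x ∈ Finset.Ico (u k) (v k), δ / 2 * (1 / (x : ℝ)) := by
        refine (Finset.abs_sum_le_sum_abs _ _).trans (Finset.sum_le_sum fun x hx => ?_)
        rw [Finset.mem_Ico] at hx
        have hx0 : (0 : ℝ) < x := by exact_mod_cast h2.trans hx.1
        have h4 := hx₀ x (h1.trans hx.1)
        rw [Real.dist_eq, inv_div] at h4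
        have h5 : 1 / growth T x - c⁻¹ * (1 / (x : ℝ)) = (x / growth T x - c⁻¹) * (1 / x) := by
          have := (growth_pos T x).ne'
          field_simp
        rw [h5, abs_mul, abs_of_pos (by positivity : 0 < 1 / (x : ℝ))]
        exact mul_le_mul_of_nonneg_right h4.le (by positivity)
    _ = δ / 2 * ∑ x ∈ Finset.Ico (u k) (v k), 1 / (x : ℝ) := by rw [Finset.mul_sum]
    _ ≤ δ / 2 * (|Real.log t| + 1) := by gcongr
    _ < ε := by
      rw [hδ]
      field_simp
      linarith

/-- The expected number of ending sticks with lengths between `u` and `v` is asymptotic to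
a multiple of `log (v / u)`. -/
theorem tendsto_sourceSum_onDead_one_sub {T : Set ℕ} {c : ℝ} (hc0 : 0 < c)
    (hc : Tendsto (fun m : ℕ => growth T m / m) atTop (𝓝 c))
    {u v : ℕ → ℕ} {t : ℝ} (ht : 0 < t) (hu : Tendsto u atTop atTop)
    (huv : ∀ k, u k ≤ v k) (hvu : Tendsto (fun k => (v k : ℝ) / u k) atTop (𝓝 t)) :
    Tendsto (fun k => sourceSum T (onDead T 1) (v k) - sourceSum T (onDead T 1) (u k)) atTop
      (𝓝 ((2 * c)⁻¹ * Real.log t)) := by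
  have hv : Tendsto v atTop atTop := tendsto_atTop_mono huv hu
  have h1 := hc.inv₀ hc0.ne'
  have h2 := (((tendsto_sum_Ico_one_div_growth hc0 hc ht hu huv hvu).add (h1.comp hv)).sub
    (h1.comp hu)).div_const 2
  rw [show (c⁻¹ * Real.log t + c⁻¹ - c⁻¹) / 2 = (2 * c)⁻¹ * Real.log t by
    rw [mul_inv]; ring] at h2
  refine h2.congr' ?_
  filter_upwards [hu.eventually_ge_atTop 1] with k hk
  simp only [Function.comp, inv_div]
  rw [sourceSum_onDead_one T hk, sourceSum_onDead_one T (hk.trans (huv k)),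
    ← Finset.sum_Ico_consecutive _ hk (huv k)]
  ring

theorem sourceSum_mono {T : Set ℕ} {g : ℕ → ℝ} (hg : ∀ x, 0 ≤ g x) {l m : ℕ} (h : l ≤ m) :
    sourceSum T g l ≤ sourceSum T g m :=
  Finset.sum_le_sum_of_subset_of_nonneg (Finset.Ico_subset_Ico_right h)
    fun x _ _ => div_nonneg (hg x) (growth_pos T _).le

theorem monotone_ceil_pow {B : ℝ} (hB : 1 < B) : Monotone fun k : ℕ => ⌈B ^ k⌉₊ := fun _ _ h =>
  Nat.ceil_mono (pow_le_pow_right₀ hB.le h)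

theorem tendsto_ceil_pow {B : ℝ} (hB : 1 < B) : Tendsto (fun k : ℕ => ⌈B ^ k⌉₊) atTop atTop :=
  tendsto_nat_ceil_atTop.comp (tendsto_pow_atTop_atTop_of_one_lt hB)

theorem tendsto_ceil_pow_div {B : ℝ} (hB : 1 < B) :
    Tendsto (fun k : ℕ => (⌈B ^ k⌉₊ : ℝ) / B ^ k) atTop (𝓝 1) :=
  (tendsto_nat_ceil_div_atTop (R := ℝ)).comp (tendsto_pow_atTop_atTop_of_one_lt hB)

theorem one_le_ceil_pow {B : ℝ} (hB : 1 < B) (k : ℕ) : 1 ≤ ⌈B ^ k⌉₊ :=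
  Nat.one_le_ceil_iff.2 (pow_pos (by linarith) k)

/-! ### From blocks of significands to logarithmic asymptotics -/

/-- If the contributions to `sourceSum` of the blocks `[B ^ k, B ^ (k + 1))` tend to `b`, then
`sourceSum` grows like `b * log_B`. -/
theorem tendsto_sourceSum_div_log {T : Set ℕ} {g : ℕ → ℝ} (hg : ∀ x, 0 ≤ g x) {B b : ℝ}
    (hB : 1 < B) (hb : Tendsto (fun k => sourceSum T g ⌈B ^ (k + 1)⌉₊ - sourceSum T g ⌈B ^ k⌉₊)
      atTop (𝓝 b)) :
    Tendsto (fun l : ℕ => sourceSum T g l / Real.logb B l) atTop (𝓝 b) := by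
  -- Cesàro means along the powers of `B`; other lengths are squeezed between consecutive powers by
  -- monotonicity.
  have h1 : Tendsto (fun K : ℕ => sourceSum T g ⌈B ^ K⌉₊ / (K : ℝ)) atTop (𝓝 b) := by
    refine hb.cesaro.congr fun K => ?_
    rw [Finset.sum_range_sub (fun k => sourceSum T g ⌈B ^ k⌉₊)]
    simp [sourceSum]
    ring
  have hlog : Tendsto (fun l : ℕ => Real.logb B l) atTop atTop :=
    (Real.tendsto_logb_atTop hB).comp tendsto_natCast_atTop_atTop
  have hK : Tendsto (fun l : ℕ => ⌊Real.logb B l⌋₊) atTop atTop := tendsto_nat_floor_atTop.comp hlog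
  have h2 : Tendsto (fun l : ℕ => (⌊Real.logb B l⌋₊ : ℝ) / Real.logb B l) atTop (𝓝 1) :=
    (tendsto_nat_floor_div_atTop (R := ℝ)).comp hlog
  have h3 : Tendsto (fun l : ℕ => ((⌊Real.logb B l⌋₊ + 1 : ℕ) : ℝ) / Real.logb B l) atTop
      (𝓝 1) := by
    have := h2.add (tendsto_inv_atTop_zero.comp hlog)
    rw [add_zero] at this
    refine this.congr fun l => ?_
    push_cast
    simp only [Function.comp]
    ring
  have h4 := (h1.comp hK).mul h2
  have h5 := (h1.comp ((tendsto_add_atTop_nat 1).comp hK)).mul h3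
  rw [mul_one] at h4 h5
  have hev : ∀ᶠ l : ℕ in atTop, 1 ≤ l ∧ 1 ≤ ⌊Real.logb B l⌋₊ ∧ 0 < Real.logb B l :=
    (eventually_ge_atTop 1).and ((hK.eventually_ge_atTop 1).and (hlog.eventually_gt_atTop 0))
  refine tendsto_of_tendsto_of_tendsto_of_le_of_le' h4 h5 ?_ ?_
  · filter_upwards [hev] with l ⟨hl, hk, hl0⟩
    have hl' : (0 : ℝ) < l := by exact_mod_cast hl
    have hk' : (0 : ℝ) < ⌊Real.logb B l⌋₊ := by exact_mod_cast hk
    simp only [Function.comp]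
    rw [div_mul_div_cancel₀ hk'.ne']
    refine div_le_div_of_nonneg_right (sourceSum_mono hg (Nat.ceil_le.2 ?_)) hl0.le
    rw [← Real.rpow_natCast, ← Real.le_logb_iff_rpow_le hB hl']
    exact Nat.floor_le hl0.le
  · filter_upwards [hev] with l ⟨hl, hk, hl0⟩
    have hl' : (0 : ℝ) < l := by exact_mod_cast hl
    simp only [Function.comp]
    rw [div_mul_div_cancel₀ (by positivity)]
    refine div_le_div_of_nonneg_right (sourceSum_mono hg ?_) hl0.le
    have h6 : (l : ℝ) < B ^ (⌊Real.logb B l⌋₊ + 1) := by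
      rw [← Real.rpow_natCast, ← Real.logb_lt_iff_lt_rpow hB hl']
      push_cast
      exact Nat.lt_floor_add_one _
    exact_mod_cast h6.le.trans (Nat.le_ceil _)

open Classical in
/-- The indicator function of the lengths with significand at most `s`. -/
noncomputable def significandLE (B s : ℝ) (x : ℕ) : ℝ := if significand B (x : ℝ) ≤ s then 1 else 0

theorem significandLE_eq {B s : ℝ} (hB : 1 < B) {k x : ℕ} (hx1 : ⌈B ^ k⌉₊ ≤ x)
    (hx2 : x < ⌈B ^ (k + 1)⌉₊) :
    significandLE B s x = if x < ⌊s * B ^ k⌋₊ + 1 then 1 else 0 := by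
  have hBk : 0 < B ^ k := pow_pos (by linarith) k
  have h1 : B ^ k ≤ x := Nat.ceil_le.1 hx1
  have h2 : (x : ℝ) < B ^ (k + 1) := Nat.lt_ceil.1 hx2
  have hx0 : (0 : ℝ) < x := hBk.trans_le h1
  have hfl : ⌊Real.logb B x⌋ = (k : ℤ) := by
    rw [Int.floor_eq_iff]
    constructor
    · rw [Real.le_logb_iff_rpow_le hB hx0]
      exact_mod_cast h1
    · rw [Real.logb_lt_iff_lt_rpow hB hx0]
      exact_mod_cast h2
  rw [significandLE, significand, hfl, zpow_natCast]
  congr 1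
  rw [div_le_iff₀ hBk, Nat.lt_succ_iff]
  have hx : x ≠ 0 := by
    rintro rfl
    simp at hx0
  rw [eq_iff_iff, Nat.le_floor_iff' hx]

/-- Within a block the significand is `x / B ^ k`, so the lengths that count form the initial
segment up to `s * B ^ k`. -/
theorem sum_Ico_significandLE (T : Set ℕ) {B s : ℝ} (hB : 1 < B) (hs : s ∈ Set.Ico 1 B) (k : ℕ) :
    sourceSum T (onDead T (significandLE B s)) ⌈B ^ (k + 1)⌉₊ -
      sourceSum T (onDead T (significandLE B s)) ⌈B ^ k⌉₊ =
    sourceSum T (onDead T 1) (⌊s * B ^ k⌋₊ + 1) - sourceSum T (onDead T 1) ⌈B ^ k⌉₊ := by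
  have hBk : 0 < B ^ k := pow_pos (by linarith) k
  have h1 : ⌈B ^ k⌉₊ ≤ ⌊s * B ^ k⌋₊ + 1 := by
    rw [Nat.ceil_le]
    push_cast
    exact (by nlinarith [hs.1] : B ^ k ≤ s * B ^ k).trans (Nat.lt_floor_add_one _).le
  have h2 : ⌊s * B ^ k⌋₊ + 1 ≤ ⌈B ^ (k + 1)⌉₊ := by
    rw [Nat.succ_le_iff, Nat.lt_ceil]
    refine (Nat.floor_le (by nlinarith [hs.1])).trans_lt ?_
    rw [pow_succ, mul_comm]
    gcongr
    exact hs.2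
  have h0 := one_le_ceil_pow hB k
  simp only [sourceSum]
  rw [← Finset.sum_Ico_consecutive _ h0 h1, ← Finset.sum_Ico_consecutive _ h0 (h1.trans h2),
    ← Finset.sum_Ico_consecutive _ h1 h2]
  have h3 : ∑ x ∈ Finset.Ico (⌊s * B ^ k⌋₊ + 1) ⌈B ^ (k + 1)⌉₊,
      onDead T (significandLE B s) x / growth T (x + 1) = 0 := by
    refine Finset.sum_eq_zero fun x hx => ?_
    rw [Finset.mem_Ico] at hx
    rw [onDead, significandLE_eq hB (h1.trans hx.1) hx.2, if_neg (not_lt.2 hx.1), ite_self,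
      zero_div]
  have h4 : ∑ x ∈ Finset.Ico ⌈B ^ k⌉₊ (⌊s * B ^ k⌋₊ + 1),
      onDead T (significandLE B s) x / growth T (x + 1) =
      ∑ x ∈ Finset.Ico ⌈B ^ k⌉₊ (⌊s * B ^ k⌋₊ + 1), onDead T 1 x / growth T (x + 1) := by
    refine Finset.sum_congr rfl fun x hx => ?_
    rw [Finset.mem_Ico] at hx
    rw [onDead, onDead, significandLE_eq hB hx.1 (hx.2.trans_le h2), if_pos hx.2, Pi.one_apply]
  rw [h3, h4]
  ring

theorem tendsto_sourceSum_one {T : Set ℕ} {c : ℝ} (hc0 : 0 < c)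
    (hc : Tendsto (fun m : ℕ => growth T m / m) atTop (𝓝 c)) {B : ℝ} (hB : 1 < B) :
    Tendsto (fun l : ℕ => sourceSum T (onDead T 1) l / Real.logb B l) atTop
      (𝓝 ((2 * c)⁻¹ * Real.log B)) := by
  refine tendsto_sourceSum_div_log (fun x => ?_) hB ?_
  · unfold onDead
    split_ifs <;> simp
  · refine tendsto_sourceSum_onDead_one_sub hc0 hc (by linarith) (tendsto_ceil_pow hB)
      (fun k => monotone_ceil_pow hB k.le_succ) ?_
    have h1 := tendsto_ceil_pow_div hB
    have h2 := ((h1.comp (tendsto_add_atTop_nat 1)).div h1 one_ne_zero).mul_const B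
    rw [div_one, one_mul] at h2
    refine h2.congr fun k => ?_
    have h3 : B ≠ 0 := by linarith
    have h4 : (⌈B ^ k⌉₊ : ℝ) ≠ 0 := by
      have := one_le_ceil_pow hB k
      positivity
    simp only [Function.comp, pow_succ, Pi.div_apply]
    field_simp

theorem tendsto_sourceSum_significandLE {T : Set ℕ} {c : ℝ} (hc0 : 0 < c)
    (hc : Tendsto (fun m : ℕ => growth T m / m) atTop (𝓝 c)) {B s : ℝ} (hB : 1 < B)
    (hs : s ∈ Set.Ico 1 B) :
    Tendsto (fun l : ℕ => sourceSum T (onDead T (significandLE B s)) l / Real.logb B l) atTop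
      (𝓝 ((2 * c)⁻¹ * Real.log s)) := by
  have hs0 : 0 < s := by linarith [hs.1]
  refine tendsto_sourceSum_div_log (fun x => ?_) hB ?_
  · unfold onDead significandLE
    split_ifs <;> simp
  · simp only [sum_Ico_significandLE T hB hs]
    refine tendsto_sourceSum_onDead_one_sub hc0 hc (by linarith) (tendsto_ceil_pow hB)
      (v := fun k => ⌊s * B ^ k⌋₊ + 1) (fun k => ?_) ?_
    · rw [Nat.ceil_le]
      push_cast
      exact (by nlinarith [hs.1, pow_pos (by linarith : 0 < B) k] : B ^ k ≤ s * B ^ k).trans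
        (Nat.lt_floor_add_one _).le
    · have hp := tendsto_pow_atTop_atTop_of_one_lt hB
      have h1 := (tendsto_nat_floor_mul_div_atTop hs0.le).comp hp
      have h2 := ((h1.add (tendsto_inv_atTop_zero.comp hp)).div (tendsto_ceil_pow_div hB)
        one_ne_zero)
      rw [add_zero, div_one] at h2
      refine h2.congr fun k => ?_
      have h4 : (⌈B ^ k⌉₊ : ℝ) ≠ 0 := by
        have := one_le_ceil_pow hB k
        positivity
      have h5 : B ^ k ≠ 0 := pow_ne_zero _ (by linarith)
      simp only [Function.comp, Pi.div_apply]
      push_cast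
      field_simp

/-! ### Martingale and variance bound -/

theorem integral_breakStick_moment_of_alive {T : Set ℕ} (g : ℕ → ℝ) {l : ℕ} (h : Alive T l) :
    ∫ a, total (moment T g) a ∂(breakStick T l).toMeasure = moment T g l - g l := by
  rw [integral_breakStick_of_alive h, moment_of_alive g h, ← sum_moment_add]
  simp [total]

/-- The source vanishes at living lengths, so breaking a stick preserves the expected value: this is
the martingale property. -/
theorem integral_breakStick_moment_onDead (T : Set ℕ) (f : ℕ → ℝ) (l : ℕ) :
    ∫ a, total (moment T (onDead T f)) a ∂(breakStick T l).toMeasure =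
      moment T (onDead T f) l := by
  by_cases h : Alive T l
  · rw [integral_breakStick_moment_of_alive _ h, onDead, if_pos h, sub_zero]
  · rw [integral_breakStick_of_not_alive h, total_cons, total_nil, add_zero]

theorem moment_nonneg {T : Set ℕ} {g : ℕ → ℝ} (hg : ∀ x, 0 ≤ g x) (l : ℕ) :
    0 ≤ moment T g l := by
  rw [moment]
  refine add_nonneg (hg l) ?_
  split_ifs with h
  · have := one_lt_of_alive h
    have h1 := growth_pos T l
    exact mul_nonneg (div_nonneg (by linarith) (by linarith))
      (Finset.sum_nonneg fun x _ => div_nonneg (hg x) (growth_pos T _).le)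
  · exact le_rfl

theorem total_nonneg {f : ℕ → ℝ} (hf : ∀ x, 0 ≤ f x) (c : List ℕ) : 0 ≤ total f c := by
  refine List.sum_nonneg fun y hy => ?_
  obtain ⟨x, _, rfl⟩ := List.mem_map.1 hy
  exact hf x

theorem total_congr {f g : ℕ → ℝ} {c : List ℕ} (h : ∀ x ∈ c, f x = g x) :
    total f c = total g c := by
  rw [total, total, List.map_congr_left h]

theorem abs_onDead_le {T : Set ℕ} {f : ℕ → ℝ} (hf : ∀ x, |f x| ≤ 1) (x : ℕ) :
    |onDead T f x| ≤ 1 := by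
  unfold onDead
  split_ifs
  · simp
  · exact hf x

theorem exists_integral_endingLaw_sq_le {T : Set ℕ} {c : ℝ} (hc0 : 0 < c)
    (hc : Tendsto (fun m : ℕ => growth T m / m) atTop (𝓝 c)) :
    ∃ K : ℝ, 0 < K ∧ ∀ f : ℕ → ℝ, (∀ x, |f x| ≤ 1) → ∀ (L R : ℕ) (t : ℝ), 1 ≤ L →
      ∫ d, (total f d - t) ^ 2 ∂(endingLaw T L R).toMeasure ≤
        (R * moment T (onDead T f) L - t) ^ 2 + R * (K * (1 + Real.log L) ^ 3) := by
  obtain ⟨K, hK0, hK⟩ := exists_abs_moment_le hc0 hc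
  refine ⟨9 * K ^ 3, by positivity, fun f hf L R t hL => ?_⟩
  set M := moment T (onDead T f) with hMdef
  -- Bounds the variance of one break: the two pieces and the parent each contribute at most `K * (1
  -- + log l)` in absolute value, hence the square of three times that.
  set g : ℕ → ℝ := fun l => 9 * (K * (1 + Real.log l)) ^ 2 with hgdef
  have hMle : ∀ x l : ℕ, 1 ≤ x → x ≤ l → |M x| ≤ K * (1 + Real.log l) := by
    intro x l hx hxl
    have h1 := hK (onDead T f) 1 x hx fun y _ _ => abs_onDead_le hf y
    have h2 : Real.log x ≤ Real.log l :=
      Real.log_le_log (by exact_mod_cast hx) (by exact_mod_cast hxl)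
    rw [one_mul] at h1
    exact h1.trans (by gcongr)
  have hM : ∀ l, ∫ a, total M a ∂(breakStick T l).toMeasure = M l :=
    integral_breakStick_moment_onDead T f
  have hg0 : ∀ x, 0 ≤ g x := fun x => by positivity
  have hvar : ∀ l, Alive T l →
      ∫ a, (total M a - M l) ^ 2 ∂(breakStick T l).toMeasure ≤ g l := by
    intro l h
    have h1 := one_lt_of_alive h
    rw [integral_breakStick_of_alive h, div_le_iff₀ (by linarith)]
    have h2 : ∀ x ∈ Finset.Ico 1 l, (total M [x, l - x] - M l) ^ 2 ≤ g l := by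
      intro x hx
      rw [Finset.mem_Ico] at hx
      have e1 := abs_le.1 (hMle x l hx.1 hx.2.le)
      have e2 := abs_le.1 (hMle (l - x) l (by omega) (by omega))
      have e3 := abs_le.1 (hMle l l (by omega) le_rfl)
      simp only [total_cons, total_nil, hgdef]
      rw [show 9 * (K * (1 + Real.log l)) ^ 2 = (3 * (K * (1 + Real.log l))) ^ 2 by ring]
      refine sq_le_sq' ?_ ?_ <;> linarith
    refine (Finset.sum_le_card_nsmul _ _ _ h2).trans ?_
    rw [Nat.card_Ico, nsmul_eq_mul, Nat.cast_sub (by have := h.2; omega), mul_comm]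
    simp
  have hQ : ∀ l, ∫ a, (total M a - M l) ^ 2 ∂(breakStick T l).toMeasure +
      ∫ a, total (moment T g) a ∂(breakStick T l).toMeasure ≤ moment T g l := by
    intro l
    by_cases h : Alive T l
    · rw [integral_breakStick_moment_of_alive g h]
      linarith [hvar l h]
    · simp [integral_breakStick_of_not_alive h, total_cons, total_nil]
  have hmain := integral_fragmentation_le hM hQ (List.replicate R L) L t
  rw [total_replicate, total_replicate] at hmain
  -- The logarithmic bound for solutions, with `g L` as the bound on the source, supplies the third
  -- power of the logarithm.
  have hQL : moment T g L ≤ 9 * K ^ 3 * (1 + Real.log L) ^ 3 := by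
    refine (le_abs_self _).trans ((hK g (g L) L hL fun x hx hxL => ?_).trans (le_of_eq ?_))
    · have h2 : Real.log x ≤ Real.log L :=
        Real.log_le_log (by exact_mod_cast hx) (by exact_mod_cast hxL)
      have h3 : 0 ≤ Real.log x := Real.log_nonneg (by exact_mod_cast hx)
      rw [abs_of_nonneg (hg0 x)]
      simp only [hgdef]
      gcongr
    · simp only [hgdef]
      ring
  calc _ ≤ ∫ d, ((total M d - t) ^ 2 + total (moment T g) d) ∂(endingLaw T L R).toMeasure := by
        refine PMF.integral_mono_of_finite_support (finite_support_fragmentation _ _ _)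
          fun d hd => ?_
        -- All ending sticks are dead, and on dead lengths `M` agrees with `f`.
        have h1 : total f d = total M d := total_congr fun x hx => by
          have h := not_alive_of_mem_endingLaw hd hx
          rw [hMdef, moment_of_not_alive _ h, onDead, if_neg h]
        rw [h1]
        linarith [total_nonneg (moment_nonneg (T := T) hg0) d]
    _ ≤ _ := hmain
    _ ≤ _ := by gcongr

/-! ### From additive functionals to proportions -/

theorem total_significandLE (B s : ℝ) (c : List ℕ) :
    total (significandLE B s) c = proportion B s c * c.length := by
  rcases eq_or_ne c [] with rfl | hc
  · simp [total_nil]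
  · have h0 : (c.length : ℝ) ≠ 0 := by
      simpa using hc
    rw [proportion, div_mul_cancel₀ _ h0]
    clear hc h0
    induction c with
    | nil => simp [total_nil]
    | cons l c ih =>
      rw [total_cons, ih, List.countP_cons, significandLE]
      by_cases h : significand B (l : ℝ) ≤ s <;> simp [h, add_comm]

theorem total_one (c : List ℕ) : total 1 c = c.length := by
  simp [total, Pi.one_def]

theorem proportion_mem_Icc (B s : ℝ) (c : List ℕ) : proportion B s c ∈ Set.Icc 0 1 := by
  constructor
  · exact div_nonneg (Nat.cast_nonneg _) (Nat.cast_nonneg _)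
  · exact div_le_one_of_le₀ (by exact_mod_cast List.countP_le_length) (Nat.cast_nonneg _)

/-- With `N` the number of sticks, write `m * (P - ρ) = N * (P - ρ) - (N - m) * (P - ρ)`: the first
term is additive in the sticks, and `|P - ρ| ≤ 1` in the second. Here `m` will be the mean count,
replacing the random denominator. -/
theorem sq_proportion_sub_le {B s ρ m : ℝ} (hρ : ρ ∈ Set.Icc 0 1) (c : List ℕ) :
    m ^ 2 * (proportion B s c - ρ) ^ 2 ≤
      2 * total (fun x => significandLE B s x - ρ) c ^ 2 + 2 * (total 1 c - m) ^ 2 := by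
  have h1 : total (fun x => significandLE B s x - ρ) c = (proportion B s c - ρ) * total 1 c := by
    rw [sub_mul, total_one, ← total_significandLE]
    induction c with
    | nil => simp [total_nil]
    | cons l c ih =>
      simp only [total_cons, ih, List.length_cons]
      push_cast
      ring
  rw [h1]
  set P := proportion B s c with hP
  set N := total 1 c
  have h2 : (P - ρ) ^ 2 ≤ 1 := by
    have := proportion_mem_Icc B s c
    rw [← hP] at this
    rw [sq_le_one_iff_abs_le_one, abs_le]
    exact ⟨by linarith [this.1, hρ.2], by linarith [this.2, hρ.1]⟩
  have h3 : m * (P - ρ) = (P - ρ) * N - (P - ρ) * (N - m) := by ring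
  rw [← mul_pow, h3]
  nlinarith [sq_nonneg ((P - ρ) * N + (P - ρ) * (N - m)),
    mul_le_mul_of_nonneg_right h2 (sq_nonneg (N - m))]

theorem integral_sq_sub_eq {p : PMF (List ℕ)} (hp : p.support.Finite) (X : List ℕ → ℝ) (ρ : ℝ) :
    ∫ c, (X c - ρ) ^ 2 ∂p.toMeasure =
      variance X p.toMeasure + (∫ c, X c ∂p.toMeasure - ρ) ^ 2 := by
  have hi := PMF.integrable_of_finite_support hp
  rw [variance_eq_integral (hi X).aemeasurable]
  set e := ∫ c, X c ∂p.toMeasure with he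
  have h : ∀ c, (X c - ρ) ^ 2 = (X c - e) ^ 2 + (2 * (e - ρ) * X c + (ρ ^ 2 - e ^ 2)) := by
    intro c
    ring
  simp_rw [h]
  rw [integral_add (hi _) (hi _), integral_add (hi _) (hi _), integral_const_mul, ← he]
  simp
  ring

/-- The mean square distance to `log_B s` is the variance plus the squared bias, so both limits
follow from this one. -/
theorem convergesToStrongBenford_of_tendsto {B : ℝ} {p : ℕ → PMF (List ℕ)}
    (hp : ∀ k, (p k).support.Finite)
    (h : ∀ s ∈ Set.Ico 1 B, Tendsto (fun k => ∫ c, (proportion B s c - Real.logb B s) ^ 2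
      ∂(p k).toMeasure) atTop (𝓝 0)) : ConvergesToStrongBenford B p := by
  intro s hs
  have h1 := h s hs
  simp only [integral_sq_sub_eq (hp _)] at h1
  constructor
  · have h2 : Tendsto (fun k => (∫ c, proportion B s c ∂(p k).toMeasure - Real.logb B s) ^ 2)
        atTop (𝓝 0) :=
      squeeze_zero (fun k => sq_nonneg _)
        (fun k => le_add_of_nonneg_left (variance_nonneg _ _)) h1
    rw [← tendsto_sub_nhds_zero_iff, tendsto_zero_iff_abs_tendsto_zero]
    have h3 := h2.sqrt
    rw [Real.sqrt_zero] at h3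
    exact h3.congr fun k => Real.sqrt_sq_eq_abs _
  · exact squeeze_zero (fun k => variance_nonneg _ _)
      (fun k => le_add_of_nonneg_right (sq_nonneg _)) h1

theorem sourceSum_onDead_sub (T : Set ℕ) (f : ℕ → ℝ) (ρ : ℝ) (m : ℕ) :
    sourceSum T (onDead T fun x => f x - ρ) m =
      sourceSum T (onDead T f) m - ρ * sourceSum T (onDead T 1) m := by
  simp only [sourceSum]
  rw [Finset.mul_sum, ← Finset.sum_sub_distrib]
  refine Finset.sum_congr rfl fun x _ => ?_
  simp only [onDead]
  split_ifs
  · simp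
  · simp only [Pi.one_apply]
    ring

theorem tendsto_growth_div_sub_one {T : Set ℕ} {c : ℝ}
    (hc : Tendsto (fun m : ℕ => growth T m / m) atTop (𝓝 c)) :
    Tendsto (fun l : ℕ => 2 * growth T l / ((l : ℝ) - 1)) atTop (𝓝 (2 * c)) := by
  have h1 : Tendsto (fun l : ℕ => ((l : ℝ))⁻¹) atTop (𝓝 0) := tendsto_inv_atTop_nhds_zero_nat
  have h2 := (hc.const_mul 2).div (h1.const_sub 1) (by norm_num)
  rw [sub_zero, div_one] at h2
  refine h2.congr' ?_
  filter_upwards [eventually_ge_atTop 2] with l hl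
  have h3 : (2 : ℝ) ≤ l := by exact_mod_cast hl
  have h4 : (l : ℝ) - 1 ≠ 0 := by linarith
  have h5 : (1 : ℝ) - (l : ℝ)⁻¹ ≠ 0 := by
    have : (l : ℝ)⁻¹ ≤ 2⁻¹ := by gcongr
    linarith
  simp only [Pi.div_apply]
  field_simp

theorem moment_onDead_of_alive {T : Set ℕ} (f : ℕ → ℝ) {l : ℕ} (h : Alive T l) :
    moment T (onDead T f) l = 2 * growth T l / (l - 1) * sourceSum T (onDead T f) l := by
  rw [moment, if_pos h, onDead, if_pos h, zero_add]

/-! ### Strong Benford behavior under linear growth -/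

/-- Strong Benford behavior for every set `T` for which `growth` grows linearly. -/
theorem convergesToStrongBenford_endingLaw {T : Set ℕ} {c : ℝ} (hc0 : 0 < c)
    (hc : Tendsto (fun m : ℕ => growth T m / m) atTop (𝓝 c)) {B : ℝ} (hB : 1 < B)
    {L R : ℕ → ℕ} (hL : ∀ k, Alive T (L k)) (hL_lim : Tendsto L atTop atTop)
    (hR : ∀ k, Real.log (L k) ^ 3 < R k) :
    ConvergesToStrongBenford B fun k => endingLaw T (L k) (R k) := by
  refine convergesToStrongBenford_of_tendsto (fun k => finite_support_fragmentation _ _ _)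
    fun s hs => ?_
  obtain ⟨K, hK0, hK⟩ := exists_integral_endingLaw_sq_le hc0 hc
  set ρ := Real.logb B s with hρdef
  have hρ : ρ ∈ Set.Icc 0 1 := by
    refine ⟨Real.logb_nonneg hB hs.1, ?_⟩
    rw [← Real.logb_self_eq_one hB]
    exact Real.logb_le_logb_of_le hB (by linarith [hs.1]) hs.2.le
  set f : ℕ → ℝ := fun x => significandLE B s x - ρ with hf
  have hf1 : ∀ x, |f x| ≤ 1 := by
    intro x
    simp only [hf, significandLE, abs_le]
    split_ifs <;> constructor <;> linarith [hρ.1, hρ.2]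
  have hlB : 0 < Real.log B := Real.log_pos hB
  have hA := (tendsto_growth_div_sub_one hc).comp hL_lim
  have hN : Tendsto (fun k => moment T (onDead T 1) (L k) / Real.logb B (L k)) atTop
      (𝓝 (Real.log B)) := by
    have h := hA.mul ((tendsto_sourceSum_one hc0 hc hB).comp hL_lim)
    rw [mul_inv_cancel_left₀ (by positivity)] at h
    refine h.congr fun k => ?_
    rw [moment_onDead_of_alive _ (hL k)]
    simp only [Function.comp]
    ring
  -- The leading terms cancel because `ρ * log B = log s`; the centred functional has mean of
  -- smaller order than the count.
  have hF : Tendsto (fun k => moment T (onDead T f) (L k) / Real.logb B (L k)) atTop (𝓝 0) := by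
    have h := hA.mul (((tendsto_sourceSum_significandLE hc0 hc hB hs).comp hL_lim).sub
      (((tendsto_sourceSum_one hc0 hc hB).comp hL_lim).const_mul ρ))
    have h0 : 2 * c * ((2 * c)⁻¹ * Real.log s - ρ * ((2 * c)⁻¹ * Real.log B)) = 0 := by
      rw [hρdef, Real.logb]
      field_simp
      ring
    rw [h0] at h
    refine h.congr fun k => ?_
    rw [moment_onDead_of_alive _ (hL k), hf, sourceSum_onDead_sub]
    simp only [Function.comp]
    ring
  have hlog : Tendsto (fun k => Real.log (L k)) atTop atTop :=
    Real.tendsto_log_atTop.comp (tendsto_natCast_atTop_atTop.comp hL_lim)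
  have hinv : Tendsto (fun k => (Real.log (L k))⁻¹) atTop (𝓝 0) := tendsto_inv_atTop_zero.comp hlog
  -- The two summands are the bounds for the squared relative bias and the relative variance, with
  -- `R` already replaced by `(log L) ^ 3` in the second.
  have hlim : Tendsto (fun k =>
      2 * ((moment T (onDead T f) (L k) / Real.logb B (L k)) /
        (moment T (onDead T 1) (L k) / Real.logb B (L k))) ^ 2 +
      4 * K * (1 + (Real.log (L k))⁻¹) ^ 3 * ((Real.log (L k))⁻¹ * Real.log B) ^ 2 /
        (moment T (onDead T 1) (L k) / Real.logb B (L k)) ^ 2) atTop (𝓝 0) := by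
    have h := (((hF.div hN hlB.ne').pow 2).const_mul 2).add
      (((((hinv.const_add 1).pow 3).const_mul (4 * K)).mul ((hinv.mul_const (Real.log B)).pow 2)).div
        (hN.pow 2) (by positivity))
    simpa using h
  refine squeeze_zero' (Eventually.of_forall fun k => integral_nonneg fun c => sq_nonneg _) ?_ hlim
  filter_upwards [hlog.eventually_gt_atTop 0, hN.eventually_const_lt hlB] with k hk0 hNk
  have hL1 : 1 ≤ L k := by have := (hL k).2; omega
  set l := Real.log (L k) with hl
  have hlb : Real.logb B (L k) = l / Real.log B := rfl
  rw [hlb] at hNk ⊢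
  set m := moment T (onDead T 1) (L k)
  set F := moment T (onDead T f) (L k)
  have hm : 0 < m := by
    have h1 : 0 < l / Real.log B := by positivity
    exact (div_pos_iff_of_pos_right h1).1 hNk
  have hr3 := hR k
  rw [← hl] at hr3
  have hr0 : (0 : ℝ) < R k := lt_trans (by positivity) hr3
  set r : ℝ := (R k : ℝ)
  set p := endingLaw T (L k) (R k)
  have hi : ∀ f : List ℕ → ℝ, Integrable f p.toMeasure := PMF.integrable_of_finite_support
    (finite_support_fragmentation T (List.replicate (R k) (L k)) (L k))
  -- Centred at `0` rather than at its mean, so the bias `r * F` is included; the count in `h2` is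
  -- centred at its mean `r * m`.
  have h1 : ∫ d, (total f d - 0) ^ 2 ∂p.toMeasure ≤ (r * F - 0) ^ 2 + r * (K * (1 + l) ^ 3) :=
    hK f hf1 (L k) (R k) 0 hL1
  have h2 : ∫ d, (total 1 d - r * m) ^ 2 ∂p.toMeasure ≤
      (r * m - r * m) ^ 2 + r * (K * (1 + l) ^ 3) :=
    hK 1 (fun x => by simp) (L k) (R k) (r * m) hL1
  have h3 : ∫ d, (r * m) ^ 2 * (proportion B s d - ρ) ^ 2 ∂p.toMeasure ≤
      ∫ d, (2 * (total f d - 0) ^ 2 + 2 * (total 1 d - r * m) ^ 2) ∂p.toMeasure := by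
    refine PMF.integral_mono_of_finite_support (finite_support_fragmentation _ _ _) fun d _ => ?_
    rw [sub_zero]
    exact sq_proportion_sub_le hρ d
  rw [integral_add (hi _) (hi _), integral_const_mul, integral_const_mul, integral_const_mul,
    mul_comm, ← le_div_iff₀ (by positivity)] at h3
  refine h3.trans ?_
  have h4 : 2 * ∫ d, (total f d - 0) ^ 2 ∂p.toMeasure +
      2 * ∫ d, (total 1 d - r * m) ^ 2 ∂p.toMeasure ≤
      2 * (r * F) ^ 2 + 4 * (r * (K * (1 + l) ^ 3)) := by
    rw [sub_zero] at h1
    rw [sub_self] at h2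
    linarith
  refine (div_le_div_of_nonneg_right h4 (by positivity)).trans ?_
  rw [add_div]
  refine add_le_add (le_of_eq ?_) ?_
  · field_simp
  · have h5 : 4 * K * (1 + l⁻¹) ^ 3 * (l⁻¹ * Real.log B) ^ 2 / (m / (l / Real.log B)) ^ 2 =
        4 * K * (1 + l) ^ 3 / (l ^ 3 * m ^ 2) := by
      field_simp
      ring
    have h6 : 4 * (r * (K * (1 + l) ^ 3)) / (r * m) ^ 2 =
        4 * K * (1 + l) ^ 3 / (r * m ^ 2) := by
      field_simp
    rw [h5, h6]
    -- The comparison of `(log L) ^ 3` with `R` enters here.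
    gcongr

/-! ### Bounded discrepancy of the stopping set -/

theorem alive_stoppingSet_iff {n : ℕ} {S : Finset ℕ} (hS : S ⊆ Finset.range n)
    {x : ℕ} : Alive (stoppingSet n S) x ↔ 2 ≤ x ∧ x % n ∉ S := by
  have h : 2 ≤ x → (x ∈ stoppingSet n S ↔ x % n ∈ S) := by
    intro hx
    simp only [stoppingSet, Set.mem_union, Set.mem_singleton_iff, Set.mem_ofPred_eq]
    constructor
    · rintro (h | ⟨_, r, hr, q, hq⟩)
      · omega
      · have hrn := Finset.mem_range.1 (hS hr)
        have h1 : (x : ℤ) % n = r := by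
          rw [hq, mul_comm, Int.mul_add_emod_self_left]
          exact Int.emod_eq_of_lt (by positivity) (by exact_mod_cast hrn)
        have h2 : x % n = r := by exact_mod_cast h1
        rwa [h2]
    · intro h
      refine Or.inr ⟨by omega, _, h, (x / n : ℕ), ?_⟩
      exact_mod_cast (Nat.div_add_mod' x n).symm
  unfold Alive
  constructor
  · rintro ⟨h1, h2⟩
    exact ⟨h2, fun h3 => h1 ((h h2).2 h3)⟩
  · rintro ⟨h1, h2⟩
    exact ⟨fun h3 => h2 ((h h1).1 h3), h1⟩

theorem abs_sum_range_le_of_periodic {n : ℕ} (hn : 0 < n) {e : ℕ → ℝ} (he : Function.Periodic e n)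
    (he1 : ∀ x, |e x| ≤ 1) (h0 : ∑ i ∈ Finset.range n, e i = 0) (m : ℕ) :
    |∑ i ∈ Finset.range m, e i| ≤ n := by
  have hF : Function.Periodic (fun m => ∑ i ∈ Finset.range m, e i) n := by
    intro m
    induction m with
    | zero => simpa using h0
    | succ m ih =>
      simp only at ih ⊢
      rw [show m + 1 + n = m + n + 1 by ring, Finset.sum_range_succ, Finset.sum_range_succ, ih,
        he m]
  have h1 := hF.map_mod_nat m
  rw [← h1]
  refine (Finset.abs_sum_le_sum_abs _ _).trans ((Finset.sum_le_sum fun x _ => he1 x).trans ?_)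
  simpa using (Nat.mod_lt m hn).le

/-- The periodic sign `e` has mean zero over a period because exactly half of the residues are dead.
It can differ from `aliveSign` at length `1`, which is always dead, and its sums start at `0`;
correcting for `e 0`, `e 1` and the sign at `1` costs at most `3`. -/
theorem abs_sum_aliveSign_le {n : ℕ} (hn : 0 < n) (hn_even : Even n) {S : Finset ℕ}
    (hS : S ⊆ Finset.range n) (hS_card : S.card = n / 2) (m : ℕ) :
    |∑ i ∈ Finset.range m, aliveSign (stoppingSet n S) (i + 1)| ≤ n + 3 := by
  set e : ℕ → ℝ := fun x => if x % n ∈ S then -1 else 1 with hedef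
  have he1 : ∀ x, |e x| ≤ 1 := by
    intro x
    simp only [hedef]
    split_ifs <;> simp
  have hper : Function.Periodic e n := by
    intro x
    simp [hedef]
  have h0 : ∑ i ∈ Finset.range n, e i = 0 := by
    have h1 : ∀ i ∈ Finset.range n, e i = 1 - 2 * (if i ∈ S then 1 else 0) := by
      intro i hi
      simp only [hedef, Nat.mod_eq_of_lt (Finset.mem_range.1 hi)]
      split_ifs <;> norm_num
    rw [Finset.sum_congr rfl h1, Finset.sum_sub_distrib, ← Finset.mul_sum, Finset.sum_ite_mem,
      Finset.inter_eq_right.2 hS]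
    obtain ⟨j, rfl⟩ := hn_even
    simp only [Finset.sum_const, Finset.card_range, nsmul_eq_mul, mul_one, hS_card]
    rw [show (j + j) / 2 = j by omega]
    push_cast
    ring
  have hsucc : ∀ m : ℕ, ∑ i ∈ Finset.range (m + 1), aliveSign (stoppingSet n S) (i + 1) =
      ∑ i ∈ Finset.range (m + 2), e i - e 0 - e 1 + aliveSign (stoppingSet n S) 1 := by
    intro m
    induction m with
    | zero => simp [Finset.sum_range_succ]
    | succ m ih =>
      rw [Finset.sum_range_succ, ih, Finset.sum_range_succ _ (m + 2)]
      have h2 : aliveSign (stoppingSet n S) (m + 1 + 1) = e (m + 2) := by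
        simp only [aliveSign, alive_stoppingSet_iff hS, hedef]
        by_cases h : (m + 2) % n ∈ S <;> simp [h]
      rw [h2]
      ring
  cases m with
  | zero => simp; positivity
  | succ m =>
    rw [hsucc]
    have h3 := abs_le.1 (abs_sum_range_le_of_periodic hn hper he1 h0 (m + 2))
    have h4 := abs_le.1 (he1 0)
    have h5 := abs_le.1 (he1 1)
    have h6 := abs_le.1 (abs_aliveSign (stoppingSet n S) 1).le
    rw [abs_le]
    constructor <;> linarith [h3.1, h3.2]

end StickFragmentation

theorem mainTheorem9 (n : ℕ) (hn : 2 ≤ n) (hn_even : Even n)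
    (S : Finset ℕ) (hS : S ⊆ Finset.range n) (hS_card : S.card = n / 2)
    (B : ℝ) (hB : 1 < B)
    (L R : ℕ → ℕ) (hL_pos : ∀ k, 0 < L k) (hL : ∀ k, L k ∉ StickFragmentation.stoppingSet n S)
    (hL_lim : Tendsto L atTop atTop) (hR : ∀ k, Real.log (L k) ^ 3 < R k) :
    StickFragmentation.ConvergesToStrongBenford B fun k =>
      StickFragmentation.endingLaw (StickFragmentation.stoppingSet n S) (L k) (R k) := by
  obtain ⟨c, hc0, hc⟩ := StickFragmentation.exists_tendsto_growth_div
    (StickFragmentation.abs_sum_aliveSign_le (by omega) hn_even hS hS_card)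
  refine StickFragmentation.convergesToStrongBenford_endingLaw hc0 hc hB (fun k => ⟨hL k, ?_⟩)
    hL_lim hR
  have h1 : L k ≠ 1 := fun h => hL k (Or.inl h)
  have h2 := hL_pos k
  omega
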